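/- All Banach spaces are real. Let $\|a\|_1=\sum_i|a_i|$ be the standard norm of $\ell_1$ and let $\|a\|_s=\sup_k\bigl|\sum_{i=1}^k a_i\bigr|$ be the summing norm on $\ell_1$; note that $\|a\|_s\le\|a\|_1$. Call a real number $\Pi$ a *universal factorization constant* if for every nonreflexive Banach space $X$ there are bounded linear operators $S:(\ell_1,\|\cdot\|_1)\to X$ and $T:S(\ell_1)\to(\ell_1,\|\cdot\|_s)$ such that $TSa=a$ for all $a\in\ell_1$ and $\|T\|\cdot\|S\|\le\Pi$. A map $f:M\to N$ between metric spaces is an embedding with distortion at most $D$ if there is $r>0$ such that $r\,d_M(u,v)\le d_N(f(u),f(v))\le rD\,d_M(u,v)$ for all $u,v\in M$. A Banach space $Y$ is finitely representable in $X$ if for every finite-dimensional subspace $F\subseteq Y$ and every $\varepsilon>0$ there is a linear map $L:F\to X$ with $\|y\|\le\|Ly\|\le(1+\varepsilon)\|y\|$ for all $y\in F$; $X$ is superreflexive if every Banach space finitely representable in $X$ is reflexive. **Corollary.** A universal factorization constant exists. Let $\Pi$ be any universal factorization constant, let $M$ be a metric space, let $D$ and $C$ be real numbers, and suppose that there is an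 embedding $f:M\to(\ell_1,\|\cdot\|_1)$ with distortion at most $D$ such that the distances induced by $\|\cdot\|_1$ and $\|\cdot\|_s$ on $f(M)$ are $C$-equivalent, that is, $$\|f(u)-f(v)\|_1\le C\,\|f(u)-f(v)\|_s\qquad\text{for all }u,v\in M.$$ Then: 1. $M$ embeds into every nonreflexive Banach space with distortion at most $D\cdot\Pi\cdot C$. 2. If, in addition, $M$ is finite, then for every $\varepsilon>0$, $M$ embeds into every non-superreflexive Banach space with distortion at most $D\cdot\Pi\cdot C+\varepsilon$. -/

import Mathlib

universe u v

noncomputable section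

/-- The real Banach space `ℓ₁`, with its standard norm `‖a‖ = ∑ |a i|`. -/
abbrev EllOne : Type := lp (fun _ : ℕ => ℝ) 1

/-- The summing norm `‖a‖ₛ = sup_k |a 0 + ⋯ + a k|` on `ℓ₁`. -/
def summingNorm (a : EllOne) : ℝ :=
  ⨆ k : ℕ, |∑ i ∈ Finset.range (k + 1), a i|

theorem abs_partialSum_le (a : EllOne) (k : ℕ) :
    |∑ i ∈ Finset.range (k + 1), a i| ≤ ‖a‖ := by
  have h := lp.sum_rpow_le_norm_rpow (p := 1) (by norm_num) a (Finset.range (k + 1))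
  simp only [ENNReal.toReal_one, Real.rpow_one, Real.norm_eq_abs] at h
  exact (Finset.abs_sum_le_sum_abs _ _).trans h

theorem bddAbove_partialSum (a : EllOne) :
    BddAbove (Set.range fun k : ℕ => |∑ i ∈ Finset.range (k + 1), a i|) :=
  ⟨‖a‖, by rintro _ ⟨k, rfl⟩; exact abs_partialSum_le a k⟩

/-- The summing norm is always dominated by the standard norm of `ℓ₁`. -/
theorem summingNorm_le_norm (a : EllOne) : summingNorm a ≤ ‖a‖ :=
  ciSup_le (abs_partialSum_le a)

theorem abs_partialSum_le_summingNorm (a : EllOne) (k : ℕ) :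
    |∑ i ∈ Finset.range (k + 1), a i| ≤ summingNorm a :=
  le_ciSup (bddAbove_partialSum a) k

theorem summingNorm_nonneg (a : EllOne) : 0 ≤ summingNorm a :=
  (abs_nonneg _).trans (abs_partialSum_le_summingNorm a 0)

theorem eq_zero_of_summingNorm_eq_zero (a : EllOne) (h : summingNorm a = 0) : a = 0 := by
  have hs : ∀ k : ℕ, ∑ i ∈ Finset.range k, a i = 0 := by
    intro k
    cases k with
    | zero => simp
    | succ k => exact abs_nonpos_iff.mp (h ▸ abs_partialSum_le_summingNorm a k)
  apply lp.ext
  funext k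
  have h1 := hs (k + 1)
  rw [Finset.sum_range_succ, hs k, zero_add] at h1
  simpa using h1

theorem summingNorm_smul (c : ℝ) (a : EllOne) : summingNorm (c • a) = ‖c‖ * summingNorm a := by
  unfold summingNorm
  rw [Real.mul_iSup_of_nonneg (norm_nonneg c)]
  congr 1
  funext k
  simp [← Finset.mul_sum, abs_mul]

theorem summingNorm_add_le (a b : EllOne) :
    summingNorm (a + b) ≤ summingNorm a + summingNorm b := by
  refine ciSup_le fun k => ?_
  have : ∑ i ∈ Finset.range (k + 1), (a + b) i
      = ∑ i ∈ Finset.range (k + 1), a i + ∑ i ∈ Finset.range (k + 1), b i := by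
    rw [← Finset.sum_add_distrib]; rfl
  rw [this]
  exact (abs_add_le _ _).trans
    (add_le_add (abs_partialSum_le_summingNorm a k) (abs_partialSum_le_summingNorm b k))

/-- The vector space `ℓ₁`, as a type of its own to carry the summing norm:
the (incomplete) normed space `(ℓ₁, ‖·‖ₛ)`. -/
def SummingEllOne : Type := EllOne

instance : AddCommGroup SummingEllOne := inferInstanceAs (AddCommGroup EllOne)

instance : Module ℝ SummingEllOne := inferInstanceAs (Module ℝ EllOne)

/-- The identity map `(ℓ₁, ‖·‖₁) → (ℓ₁, ‖·‖ₛ)`, as a linear equivalence of vector spaces. -/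
def toSumming : EllOne ≃ₗ[ℝ] SummingEllOne := LinearEquiv.refl ℝ EllOne

instance : Norm SummingEllOne := ⟨fun a => summingNorm (toSumming.symm a)⟩

theorem summingEllOne_core : NormedSpace.Core ℝ SummingEllOne where
  norm_nonneg a := summingNorm_nonneg (toSumming.symm a)
  norm_smul c a := summingNorm_smul c (toSumming.symm a)
  norm_triangle a b := summingNorm_add_le (toSumming.symm a) (toSumming.symm b)
  norm_eq_zero_iff a := by
    constructor
    · intro h
      exact eq_zero_of_summingNorm_eq_zero (toSumming.symm a) h
    · rintro rfl
      have h := summingNorm_smul 0 0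
      simp only [zero_smul, norm_zero, zero_mul] at h
      exact h

instance : NormedAddCommGroup SummingEllOne := NormedAddCommGroup.ofCore summingEllOne_core

instance : NormedSpace ℝ SummingEllOne := NormedSpace.ofCore summingEllOne_core

theorem norm_toSumming (a : EllOne) : ‖toSumming a‖ = summingNorm a := rfl

/-- `f` is an embedding with distortion at most `D`: for some scaling factor `r > 0`,
`r * d(u, v) ≤ d(f u, f v) ≤ r * D * d(u, v)` for all `u`, `v`. -/
def HasDistortionLE {M N : Type*} [MetricSpace M] [MetricSpace N] (f : M → N) (D : ℝ) : Prop :=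
  ∃ r : ℝ, 0 < r ∧ ∀ u v : M,
    r * dist u v ≤ dist (f u) (f v) ∧ dist (f u) (f v) ≤ r * D * dist u v

/-- `M` embeds into `N` with distortion at most `D`. -/
def EmbedsWithDistortionLE (M N : Type*) [MetricSpace M] [MetricSpace N] (D : ℝ) : Prop :=
  ∃ f : M → N, HasDistortionLE f D

/-- The distances induced on `A ⊆ ℓ₁` by the `ℓ₁` norm and by the summing norm are `C`-equivalent.
The other inequality `‖x - y‖ₛ ≤ ‖x - y‖₁` always holds, see `summingNorm_le_norm`. -/
def SummingEquivalentOn (A : Set EllOne) (C : ℝ) : Prop :=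
  ∀ x ∈ A, ∀ y ∈ A, ‖x - y‖ ≤ C * summingNorm (x - y)

/-- Reflexivity of a real normed space: the canonical map into the bidual is onto. -/
def IsReflexiveSpace (X : Type*) [NormedAddCommGroup X] [NormedSpace ℝ X] : Prop :=
  Function.Surjective (NormedSpace.inclusionInDoubleDual ℝ X)

/-- `Y` is finitely representable in `X`: for every `ε > 0`, each finite-dimensional subspace of `Y`
is `(1 + ε)`-isomorphic to a subspace of `X`. -/
def FinitelyRepresentable (Y X : Type*) [NormedAddCommGroup Y] [NormedSpace ℝ Y]
    [NormedAddCommGroup X] [NormedSpace ℝ X] : Prop :=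
  ∀ F : Submodule ℝ Y, FiniteDimensional ℝ F → ∀ ε : ℝ, 0 < ε →
    ∃ L : F →ₗ[ℝ] X, ∀ y : F, ‖y‖ ≤ ‖L y‖ ∧ ‖L y‖ ≤ (1 + ε) * ‖y‖

/-- Superreflexivity of a real Banach space `X`: every Banach space which is finitely representable
in `X` is reflexive. As reflexivity is determined by the separable subspaces, it makes no difference
that `Y` ranges over the universe of `X`. -/
def IsSuperreflexive (X : Type v) [NormedAddCommGroup X] [NormedSpace ℝ X] : Prop :=
  ∀ (Y : Type v) [NormedAddCommGroup Y] [NormedSpace ℝ Y] [CompleteSpace Y],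
    FinitelyRepresentable Y X → IsReflexiveSpace Y

/-- `K` is a universal factorization constant: the identity `I : (ℓ₁, ‖·‖₁) → (ℓ₁, ‖·‖ₛ)` factors
through every nonreflexive Banach space `X` as `I = T S`, with bounded linear operators
`S : ℓ₁ → X` and `T : S(ℓ₁) → (ℓ₁, ‖·‖ₛ)` such that `‖T‖ * ‖S‖ ≤ K`. -/
def IsFactorizationConstant.{w} (K : ℝ) : Prop :=
  ∀ (X : Type w) [NormedAddCommGroup X] [NormedSpace ℝ X] [CompleteSpace X],
    ¬ IsReflexiveSpace X →
      ∃ (S : EllOne →L[ℝ] X) (T : LinearMap.range (S : EllOne →ₗ[ℝ] X) →L[ℝ] SummingEllOne),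
        (∀ a : EllOne, T ⟨S a, LinearMap.mem_range_self (S : EllOne →ₗ[ℝ] X) a⟩ = toSumming a) ∧
          ‖T‖ * ‖S‖ ≤ K

end

/-! If `I = T S` is a factorization through a nonreflexive `X`, then `‖a‖ₛ ≤ ‖T‖ ‖S a‖` and `‖S a‖ ≤
‖S‖ ‖a‖₁`. On differences of points of `f(M)` the two outer norms agree up to `C`, so `S ∘ f` has
distortion at most `D * K * C`.

That a constant exists is James's theorem (`exists_triangular_seq_of_not_reflexive`): bounded `x k`,
`f n` with `f n (x k)` equal to `1` or `0` according as `n ≤ k` or `k < n`. Sending unit vectors to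
`x k` defines `S`, and `f 0 - f (k + 1)` reads partial sums off `S a`.

For finite `M`, embed into a nonreflexive `Y` finitely representable in `X`, then carry the span of
the image into `X`. -/

/-- Helly's theorem: on finitely many functionals, a bounded functional on the dual acts
as evaluation at a point of almost the same norm. -/
theorem exists_norm_lt_forall_mem_eq {E : Type*} [NormedAddCommGroup E] [NormedSpace ℝ E]
    (Φ : StrongDual ℝ E →ₗ[ℝ] ℝ) {M R : ℝ} (hM : 0 ≤ M) (hΦ : ∀ g, |Φ g| ≤ M * ‖g‖)
    (hR : M < R) (A : Finset (StrongDual ℝ E)) :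
    ∃ x : E, ‖x‖ < R ∧ ∀ g ∈ A, g x = Φ g := by
  have hR0 : 0 < R := hM.trans_lt hR
  let G : E →ₗ[ℝ] (A → ℝ) := LinearMap.pi fun g => (g : StrongDual ℝ E).toLinearMap
  let c : A → ℝ := fun g => Φ g
  -- a functional on `A → ℝ` corresponds to a linear combination of the elements of `A`
  have heval : ∀ φ : (A → ℝ) →ₗ[ℝ] ℝ,
      ∃ v : StrongDual ℝ E, (∀ x, φ (G x) = v x) ∧ φ c = Φ v := by
    classical
    intro φ
    have hφ : ∀ w : A → ℝ, φ w = ∑ g, w g * φ (Pi.single g 1) := fun w => by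
      conv_lhs => rw [pi_eq_sum_univ' w, map_sum]
      refine Finset.sum_congr rfl fun g _ => ?_
      rw [map_smul, smul_eq_mul]
    refine ⟨∑ g : A, φ (Pi.single g 1) • (g : StrongDual ℝ E), fun x => ?_, ?_⟩
    · rw [hφ, sum_apply]
      exact Finset.sum_congr rfl fun g _ => mul_comm _ _
    · rw [hφ, map_sum]
      exact Finset.sum_congr rfl fun g _ => by rw [map_smul, smul_eq_mul, mul_comm]
  have hc : c ∈ LinearMap.range G := by
    by_contra hc
    obtain ⟨φ, hφc, hφ⟩ := Submodule.exists_le_ker_of_notMem hc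
    obtain ⟨v, hv, hvc⟩ := heval φ
    have hv0 : v = 0 := by
      ext x
      rw [← hv]
      exact hφ (LinearMap.mem_range_self G x)
    rw [hv0, map_zero] at hvc
    exact hφc hvc
  -- `G` need not be onto `A → ℝ`; restricting to its range makes the image of the ball open.
  have hopen : IsOpen (G.rangeRestrict '' Metric.ball 0 R) :=
    G.rangeRestrict.isOpenMap_of_finiteDimensional G.surjective_rangeRestrict
      _ Metric.isOpen_ball
  have hconv : Convex ℝ (G.rangeRestrict '' Metric.ball 0 R) :=
    (convex_ball (0 : E) R).linear_image G.rangeRestrict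
  by_cases hmem : (⟨c, hc⟩ : LinearMap.range G) ∈ G.rangeRestrict '' Metric.ball 0 R
  · obtain ⟨x, hx, hGx⟩ := hmem
    exact ⟨x, mem_ball_zero_iff.mp hx, fun g hg =>
      congrFun (congrArg Subtype.val hGx) (⟨g, hg⟩ : A)⟩
  obtain ⟨φ, hφ⟩ := geometric_hahn_banach_open_point hconv hopen hmem
  obtain ⟨ψ, hψ⟩ := LinearMap.exists_extend φ.toLinearMap
  have hψφ : ∀ w : LinearMap.range G, φ w = ψ w := fun w => (LinearMap.congr_fun hψ w).symm
  obtain ⟨v, hv, hvc⟩ := heval ψ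
  -- Separation would force `R * ‖v‖ ≤ Φ v ≤ M * ‖v‖` with `v ≠ 0`, against `M < R`.
  have hlt : ∀ x : E, ‖x‖ < R → v x < Φ v := by
    intro x hx
    have h := hφ _ ⟨x, mem_ball_zero_iff.mpr hx, rfl⟩
    rw [hψφ, hψφ] at h
    rw [← hv, ← hvc]
    exact h
  have hpos : 0 < Φ v := by simpa using hlt 0 (by simpa using hR0)
  have hΦv : Φ v ≤ M * ‖v‖ := (le_abs_self _).trans (hΦ v)
  have hMv : M * ‖v‖ / R < ‖v‖ := by
    rw [div_lt_iff₀ hR0, mul_comm]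
    have : 0 < ‖v‖ := (norm_nonneg v).lt_of_ne fun h => by
      rw [← h, mul_zero] at hΦv
      linarith
    gcongr
  obtain ⟨x, hx, hvx⟩ := v.exists_lt_apply_of_lt_opNorm hMv
  rw [div_lt_iff₀ hR0] at hvx
  have hnorm : ∀ y : E, ‖y‖ = ‖x‖ → ‖R • y‖ < R := fun y hy => by
    rw [norm_smul, Real.norm_of_nonneg hR0.le, hy]
    nlinarith
  have h1 := hlt _ (hnorm x rfl)
  have h2 := hlt _ (hnorm (-x) (norm_neg x))
  rw [map_smul, smul_eq_mul] at h1 h2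
  rw [map_neg] at h2
  rcases abs_cases (v x) with h | h <;> rw [Real.norm_eq_abs] at hvx <;> nlinarith

/-- The Riesz lemma for functionals: a contraction that vanishes on a closed proper subspace
takes the value `1` at a vector of norm less than `2`. -/
theorem exists_annihilator_apply_eq_one {E : Type*} [NormedAddCommGroup E] [NormedSpace ℝ E]
    (J : Submodule ℝ E) (hJ : IsClosed (J : Set E)) {z : E} (hz : z ∉ J) :
    ∃ Φ : E →ₗ[ℝ] ℝ, (∀ x, |Φ x| ≤ ‖x‖) ∧ (∀ x ∈ J, Φ x = 0) ∧ ∃ y, ‖y‖ < 2 ∧ Φ y = 1 := by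
  obtain ⟨φ, u, hu, huz⟩ := geometric_hahn_banach_closed_point J.convex hJ hz
  have hu0 : 0 < u := by simpa using hu 0 J.zero_mem
  have hφJ : ∀ x ∈ J, φ x = 0 := by
    intro x hx
    -- A functional bounded above on a subspace vanishes there: otherwise some multiple of `x`
    -- attains the value `u`.
    by_contra hne
    have h := hu ((u / φ x) • x) (J.smul_mem _ hx)
    rw [map_smul, smul_eq_mul, div_mul_cancel₀ _ hne] at h
    exact lt_irrefl _ h
  have hφ : 0 < ‖φ‖ := norm_pos_iff.mpr fun h => by
    rw [h, zero_apply] at huz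
    linarith
  obtain ⟨y, hy, hφy⟩ := φ.exists_lt_apply_of_lt_opNorm (half_lt_self hφ)
  have hy0 : 0 < ‖φ y‖ := by linarith
  refine ⟨‖φ‖⁻¹ • φ.toLinearMap, fun x => ?_, fun x hx => ?_, (‖φ‖ / φ y) • y, ?_, ?_⟩
  · have h : |φ x| ≤ ‖φ‖ * ‖x‖ := φ.le_opNorm x
    change |‖φ‖⁻¹ * φ x| ≤ ‖x‖
    rw [abs_mul, abs_of_pos (inv_pos.mpr hφ), inv_mul_le_iff₀ hφ]
    exact h
  · change ‖φ‖⁻¹ * φ x = 0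
    rw [hφJ x hx, mul_zero]
  · have h2 : ‖φ‖ / ‖φ y‖ < 2 := by
      rw [div_lt_iff₀ hy0]
      linarith
    have h0 : 0 < ‖φ‖ / ‖φ y‖ := by positivity
    rw [norm_smul, norm_div, norm_norm]
    nlinarith [norm_nonneg y]
  · have hne : φ y ≠ 0 := norm_pos_iff.mp hy0
    change ‖φ‖⁻¹ * φ ((‖φ‖ / φ y) • y) = 1
    rw [map_smul, smul_eq_mul]
    field_simp

open NormedSpace in
/-- James: a nonreflexive Banach space contains a bounded sequence `x` with a bounded sequence
of functionals `f` such that `f n (x k)` is `1` for `n ≤ k` and `0` for `k < n`. -/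
theorem exists_triangular_seq_of_not_reflexive {X : Type*} [NormedAddCommGroup X]
    [NormedSpace ℝ X] [CompleteSpace X] (hX : ¬ IsReflexiveSpace X) :
    ∃ (x : ℕ → X) (f : ℕ → StrongDual ℝ X), (∀ n, ‖x n‖ ≤ 2) ∧ (∀ n, ‖f n‖ ≤ 2) ∧
      (∀ n k, n ≤ k → f n (x k) = 1) ∧ ∀ n k, k < n → f n (x k) = 0 := by
  obtain ⟨F₀, hF₀⟩ : ∃ F₀, F₀ ∉ Set.range (inclusionInDoubleDual ℝ X) := by
    by_contra! h
    exact hX h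
  let J := LinearMap.range (inclusionInDoubleDual ℝ X).toLinearMap
  have hJ : IsClosed (J : Set (StrongDual ℝ (StrongDual ℝ X))) :=
    (inclusionInDoubleDualLi ℝ (E := X)).isometry.isUniformInducing.isComplete_range.isClosed
  obtain ⟨Φ, hΦ, hΦJ, F, hF, hΦF⟩ := exists_annihilator_apply_eq_one J hJ (z := F₀) hF₀
  -- The invariant `F z.2 = 1` keeps the recursion going: every later vector imitates `F` on the
  -- functionals chosen so far.
  let P : X × StrongDual ℝ X → Prop := fun z => ‖z.1‖ ≤ 2 ∧ ‖z.2‖ ≤ 2 ∧ F z.2 = 1 ∧ z.2 z.1 = 1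
  let r : X × StrongDual ℝ X → X × StrongDual ℝ X → Prop := fun z w => w.2 z.1 = 0 ∧ z.2 w.1 = 1
  obtain ⟨z, hz, hzr⟩ := exists_seq_of_forall_finset_exists P r fun s hs => by
    classical
    let A : Finset (StrongDual ℝ (StrongDual ℝ X)) :=
      insert F (s.image fun z => inclusionInDoubleDual ℝ X z.1)
    -- Helly in the dual: `g` imitates `Φ`, which kills `X` and is `1` at `F`. The next use, in `X`,
    -- makes `y` imitate `F`.
    obtain ⟨g, hg, hgA⟩ := exists_norm_lt_forall_mem_eq Φ zero_le_one
      (fun g => (hΦ g).trans_eq (one_mul _).symm) one_lt_two A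
    have hFg : F g = 1 := by
      rw [hgA F (by simp [A]), hΦF]
    let B : Finset (StrongDual ℝ X) := insert g (s.image Prod.snd)
    obtain ⟨y, hy, hyB⟩ := exists_norm_lt_forall_mem_eq F.toLinearMap (norm_nonneg F)
      F.le_opNorm hF B
    refine ⟨(y, g), ⟨hy.le, hg.le, hFg, ?_⟩, fun z hzs => ⟨?_, ?_⟩⟩
    · exact (hyB g (by simp [B])).trans hFg
    · have h := hgA (inclusionInDoubleDual ℝ X z.1)
        (Finset.mem_insert_of_mem (Finset.mem_image_of_mem _ hzs))
      exact h.trans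
        (hΦJ _ (LinearMap.mem_range_self (inclusionInDoubleDual ℝ X).toLinearMap z.1))
    · exact (hyB z.2
        (Finset.mem_insert_of_mem (Finset.mem_image_of_mem _ hzs))).trans (hs z hzs).2.2.1
  refine ⟨fun n => (z n).1, fun n => (z n).2, fun n => (hz n).1, fun n => (hz n).2.1,
    fun n k hnk => ?_, fun n k hkn => (hzr k n hkn).1⟩
  rcases hnk.eq_or_lt with rfl | h
  · exact (hz n).2.2.2
  · exact (hzr n k h).2

theorem EllOne.summable_norm (a : EllOne) : Summable fun i => ‖a i‖ := by
  simpa using (lp.hasSum_norm (p := 1) (by norm_num) a).summable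

theorem EllOne.tsum_norm (a : EllOne) : ∑' i, ‖a i‖ = ‖a‖ := by
  simpa using (lp.hasSum_norm (p := 1) (by norm_num) a).tsum_eq

/-- The operator on `ℓ₁` that maps the unit vectors to the terms of a bounded sequence. -/
theorem EllOne.exists_clm_hasSum {X : Type*} [NormedAddCommGroup X] [NormedSpace ℝ X]
    [CompleteSpace X] {x : ℕ → X} {R : ℝ} (hx : ∀ n, ‖x n‖ ≤ R) :
    ∃ S : EllOne →L[ℝ] X, ‖S‖ ≤ R ∧ ∀ a : EllOne, HasSum (fun i => a i • x i) (S a) := by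
  have hR : 0 ≤ R := (norm_nonneg _).trans (hx 0)
  have hbound : ∀ (a : EllOne) (i : ℕ), ‖a i • x i‖ ≤ ‖a i‖ * R := fun a i => by
    rw [norm_smul]
    exact mul_le_mul_of_nonneg_left (hx i) (norm_nonneg _)
  have hsum : ∀ a : EllOne, Summable fun i => a i • x i := fun a =>
    .of_norm_bounded (a.summable_norm.mul_right R) (hbound a)
  let S : EllOne →ₗ[ℝ] X :=
    { toFun := fun a => ∑' i, a i • x i
      map_add' := fun a b => by
        rw [← (hsum a).tsum_add (hsum b)]
        exact tsum_congr fun i => add_smul _ _ _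
      map_smul' := fun c a => by
        rw [RingHom.id_apply, ← (hsum a).tsum_const_smul c]
        exact tsum_congr fun i => mul_smul _ _ _ }
  refine ⟨S.mkContinuous R fun a => ?_, S.mkContinuous_norm_le hR _, fun a => (hsum a).hasSum⟩
  refine (tsum_of_norm_bounded (a.summable_norm.mul_right R).hasSum (hbound a)).trans_eq ?_
  rw [tsum_mul_right, a.tsum_norm, mul_comm]

/-- The James vectors give `‖S‖ ≤ 2`, and differences of two James functionals, of norm at most `4`,
give `‖T‖ ≤ 4`. -/
theorem isFactorizationConstant_eight : IsFactorizationConstant.{v} 8 := by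
  intro X _ _ _ hX
  obtain ⟨x, f, hx, hf, hone, hzero⟩ := exists_triangular_seq_of_not_reflexive hX
  obtain ⟨S, hS, hSa⟩ := EllOne.exists_clm_hasSum hx
  have hpartial : ∀ (a : EllOne) (k : ℕ),
      (f 0 - f (k + 1)) (S a) = ∑ i ∈ Finset.range (k + 1), a i := by
    intro a k
    refine ((f 0 - f (k + 1)).hasSum (hSa a)).unique ?_
    have h : ∀ i, (f 0 - f (k + 1)) (a i • x i) = if i ∈ Finset.range (k + 1) then a i else 0 := by
      intro i
      rw [map_smul, sub_apply, hone 0 i i.zero_le, smul_eq_mul]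
      split_ifs with hi
      · rw [hzero _ _ (Finset.mem_range.mp hi), sub_zero, mul_one]
      · rw [hone _ _ (not_lt.mp fun h => hi (Finset.mem_range.mpr h)), sub_self, mul_zero]
    simp only [h]
    rw [← Finset.sum_congr rfl fun i (hi : i ∈ Finset.range (k + 1)) => if_pos hi]
    exact hasSum_sum_of_ne_finset_zero fun i hi => if_neg hi
  have hlower : ∀ a : EllOne, summingNorm a ≤ 4 * ‖S a‖ := by
    intro a
    refine ciSup_le fun k => ?_
    rw [← hpartial, ← Real.norm_eq_abs]
    refine ((f 0 - f (k + 1)).le_opNorm _).trans (mul_le_mul_of_nonneg_right ?_ (norm_nonneg _))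
    linarith [norm_sub_le (f 0) (f (k + 1)), hf 0, hf (k + 1)]
  have hinj : Function.Injective (S : EllOne →ₗ[ℝ] X) := by
    refine (injective_iff_map_eq_zero _).mpr fun a ha => eq_zero_of_summingNorm_eq_zero a ?_
    have ha' : S a = 0 := ha
    have h := hlower a
    rw [ha', norm_zero, mul_zero] at h
    exact le_antisymm h (summingNorm_nonneg a)
  let e := LinearEquiv.ofInjective (S : EllOne →ₗ[ℝ] X) hinj
  let T : LinearMap.range (S : EllOne →ₗ[ℝ] X) →ₗ[ℝ] SummingEllOne :=
    toSumming.toLinearMap ∘ₗ e.symm.toLinearMap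
  have hTS : ∀ a, T (e a) = toSumming a := fun a => by simp [T]
  refine ⟨S, T.mkContinuous 4 fun y => ?_, hTS, ?_⟩
  · obtain ⟨a, rfl⟩ := e.surjective y
    rw [hTS, norm_toSumming]
    exact hlower a
  · have hT := T.mkContinuous_norm_le (C := 4) (by norm_num) fun y => by
      obtain ⟨a, rfl⟩ := e.surjective y
      rw [hTS, norm_toSumming]
      exact hlower a
    calc _ ≤ (4 : ℝ) * 2 := mul_le_mul hT hS (norm_nonneg _) (by norm_num)
      _ = 8 := by norm_num

/-- All distances vanish, so `D` may even be negative. This case is split off because the signs of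
the constants come from a pair of distinct points. -/
theorem EmbedsWithDistortionLE.of_subsingleton (M N : Type*) [MetricSpace M] [MetricSpace N]
    [Subsingleton M] [Nonempty N] (D : ℝ) : EmbedsWithDistortionLE M N D := by
  refine ⟨fun _ => Classical.arbitrary N, 1, one_pos, fun u v => ?_⟩
  rw [Subsingleton.elim u v]
  simp

theorem HasDistortionLE.nonneg {M N : Type*} [MetricSpace M] [MetricSpace N] [Nontrivial M]
    {f : M → N} {D : ℝ} (h : HasDistortionLE f D) : 0 ≤ D := by
  obtain ⟨r, hr, h⟩ := h
  obtain ⟨u, v, huv⟩ := exists_pair_ne M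
  have hd : 0 < dist u v := dist_pos.mpr huv
  have h1 : 0 ≤ r * D * dist u v := dist_nonneg.trans (h u v).2
  exact nonneg_of_mul_nonneg_right (nonneg_of_mul_nonneg_left h1 hd) hr

theorem EmbedsWithDistortionLE.of_factorization {M : Type*} [MetricSpace M] {X : Type*}
    [NormedAddCommGroup X] [NormedSpace ℝ X] {K D C : ℝ} {f : M → EllOne}
    (hf : HasDistortionLE f D) (hC : SummingEquivalentOn (Set.range f) C)
    (S : EllOne →L[ℝ] X) (T : LinearMap.range (S : EllOne →ₗ[ℝ] X) →L[ℝ] SummingEllOne)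
    (hTS : ∀ a : EllOne,
      T ⟨S a, LinearMap.mem_range_self (S : EllOne →ₗ[ℝ] X) a⟩ = toSumming a)
    (hK : ‖T‖ * ‖S‖ ≤ K) : EmbedsWithDistortionLE M X (D * K * C) := by
  cases subsingleton_or_nontrivial M
  · exact .of_subsingleton M X _
  have hD : 0 ≤ D := hf.nonneg
  obtain ⟨r, hr, hrD⟩ := hf
  have hT : ∀ a : EllOne, summingNorm a ≤ ‖T‖ * ‖S a‖ := fun a => by
    have h := T.le_opNorm ⟨S a, LinearMap.mem_range_self (S : EllOne →ₗ[ℝ] X) a⟩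
    rw [hTS, norm_toSumming] at h
    exact h
  obtain ⟨hCpos, hTpos⟩ : 0 < C ∧ 0 < ‖T‖ := by
    obtain ⟨u, v, huv⟩ := exists_pair_ne M
    have hpos : 0 < ‖f u - f v‖ := by
      rw [← dist_eq_norm]
      exact (mul_pos hr (dist_pos.mpr huv)).trans_le (hrD u v).1
    have h := hpos.trans_le (hC _ ⟨u, rfl⟩ _ ⟨v, rfl⟩)
    have hs : 0 < summingNorm (f u - f v) :=
      (summingNorm_nonneg _).lt_of_ne fun h0 => by simp [← h0] at h
    exact ⟨pos_of_mul_pos_left h hs.le,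
      pos_of_mul_pos_left (hs.trans_le (hT _)) (norm_nonneg _)⟩
  -- The scale is dictated by the lower bound `‖a‖₁ ≤ C * ‖T‖ * ‖S a‖` on differences `a`.
  refine ⟨fun u => S (f u), r / (C * ‖T‖), by positivity, fun u v => ?_⟩
  obtain ⟨h1, h2⟩ := hrD u v
  rw [dist_eq_norm] at h1 h2
  rw [dist_eq_norm, ← map_sub]
  constructor
  · rw [div_mul_eq_mul_div, div_le_iff₀ (by positivity)]
    calc r * dist u v ≤ ‖f u - f v‖ := h1
      _ ≤ C * summingNorm (f u - f v) := hC _ ⟨u, rfl⟩ _ ⟨v, rfl⟩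
      _ ≤ C * (‖T‖ * ‖S (f u - f v)‖) := mul_le_mul_of_nonneg_left (hT _) hCpos.le
      _ = _ := by ring
  · calc ‖S (f u - f v)‖ ≤ ‖S‖ * ‖f u - f v‖ := S.le_opNorm _
      _ ≤ K / ‖T‖ * (r * D * dist u v) := by
        refine mul_le_mul ?_ h2 (norm_nonneg _) ?_
        · rw [le_div_iff₀ hTpos, mul_comm]
          exact hK
        · exact div_nonneg ((mul_nonneg hTpos.le (norm_nonneg _)).trans hK) hTpos.le
      _ = _ := by field_simp

theorem EmbedsWithDistortionLE.of_finitelyRepresentable {M : Type*} [MetricSpace M] [Finite M]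
    {X Y : Type*} [NormedAddCommGroup X] [NormedSpace ℝ X] [NormedAddCommGroup Y]
    [NormedSpace ℝ Y] (hYX : FinitelyRepresentable Y X) {D ε : ℝ} (hε : 0 < ε)
    (hM : EmbedsWithDistortionLE M Y D) : EmbedsWithDistortionLE M X (D + ε) := by
  cases subsingleton_or_nontrivial M
  · exact .of_subsingleton M X _
  obtain ⟨g, hg⟩ := hM
  have hD : 0 ≤ D := hg.nonneg
  obtain ⟨r, hr, hrD⟩ := hg
  have hfin : FiniteDimensional ℝ (Submodule.span ℝ (Set.range g)) :=
    FiniteDimensional.span_of_finite ℝ (Set.finite_range g)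
  -- Chosen so that `(1 + ε / (D + 1)) * D ≤ D + ε`; the `+ 1` covers `D = 0`, as only `0 ≤ D` is at
  -- hand.
  obtain ⟨L, hL⟩ := hYX _ hfin (ε / (D + 1)) (by positivity)
  let g' : M → Submodule.span ℝ (Set.range g) := fun u => ⟨g u, Submodule.subset_span ⟨u, rfl⟩⟩
  refine ⟨fun u => L (g' u), r, hr, fun u v => ?_⟩
  obtain ⟨h1, h2⟩ := hrD u v
  obtain ⟨h3, h4⟩ := hL (g' u - g' v)
  have hnorm : ‖g' u - g' v‖ = dist (g u) (g v) := (dist_eq_norm (g u) (g v)).symm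
  rw [hnorm, map_sub, ← dist_eq_norm] at h3 h4
  refine ⟨h1.trans h3, h4.trans ?_⟩
  have hfac : (1 + ε / (D + 1)) * D ≤ D + ε := by
    have : ε / (D + 1) * D ≤ ε := by
      rw [div_mul_eq_mul_div, div_le_iff₀ (by positivity)]
      nlinarith
    linarith
  calc _ ≤ (1 + ε / (D + 1)) * (r * D * dist u v) :=
        mul_le_mul_of_nonneg_left h2 (by positivity)
    _ = r * ((1 + ε / (D + 1)) * D) * dist u v := by ring
    _ ≤ _ := by gcongr

theorem corollary1p5 :
    (∃ K : ℝ, IsFactorizationConstant.{v} K) ∧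
    ∀ K : ℝ, IsFactorizationConstant.{v} K →
      ∀ (M : Type u) [MetricSpace M] (D C : ℝ),
        (∃ f : M → EllOne, HasDistortionLE f D ∧ SummingEquivalentOn (Set.range f) C) →
          (∀ (X : Type v) [NormedAddCommGroup X] [NormedSpace ℝ X] [CompleteSpace X],
            ¬ IsReflexiveSpace X → EmbedsWithDistortionLE M X (D * K * C)) ∧
          (Finite M → ∀ ε : ℝ, 0 < ε →
            ∀ (X : Type v) [NormedAddCommGroup X] [NormedSpace ℝ X] [CompleteSpace X],
              ¬ IsSuperreflexive X → EmbedsWithDistortionLE M X (D * K * C + ε)) := by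
  refine ⟨⟨8, isFactorizationConstant_eight⟩, ?_⟩
  rintro K hK M _ D C ⟨f, hf, hC⟩
  have hmain : ∀ (X : Type v) [NormedAddCommGroup X] [NormedSpace ℝ X] [CompleteSpace X],
      ¬ IsReflexiveSpace X → EmbedsWithDistortionLE M X (D * K * C) := by
    intro X _ _ _ hX
    obtain ⟨S, T, hTS, hST⟩ := hK X hX
    exact .of_factorization hf hC S T hTS hST
  refine ⟨hmain, fun _ ε hε X _ _ _ hX => ?_⟩
  simp only [IsSuperreflexive] at hX
  push Not at hX
  obtain ⟨Y, _, _, _, hYX, hY⟩ := hX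
  exact .of_finitelyRepresentable hYX hε (hmain Y hY)
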